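/- Let $G$ be a finite group and let $R$ be a $G$-Tambara functor, i.e. a family of commutative rings $R(X)$, one for each finite $G$-set $X$, with restrictions, transfers and norms along all maps of finite $G$-sets, satisfying the usual axioms (functoriality, $R(X\sqcup Y)\cong R(X)\times R(Y)$ and $R(\emptyset)=0$, base change of transfers and norms along pullback squares, and the distributive law for exponential diagrams). A Tambara ideal $I$ of $R$ is a family of ideals $I(X)\subseteq R(X)$ that is closed under restrictions and transfers and satisfies $\mathrm{Nm}_f(a)-\mathrm{Nm}_f(0)\in I(Y)$ for every $f\colon X\to Y$ and $a\in I(X)$ (equivalently, a family of ideals $I(G/K)\subseteq R(G/K)$, $K\le G$, closed under restrictions, transfers, norms and conjugations). The product $I\cdot J$ is the Tambara ideal generated by the levelwise products $I(X)\cdot J(X)$. A Tambara ideal $\mathfrak p\neq R$ is prime if $I\cdot J\subseteq\mathfrak p$ implies $I\subseteq\mathfrak p$ or $J\subseteq\mathfrak p$. The Nakaoka spectrum $\mathrm{Spec}(R)$ is the set of prime Tambara ideals of $R$, with the topology whose closed sets are generated by the sets $V(I)=\{\mathfrak p : I\subseteq\mathfrak p\}$, for $I$ a Tambara ideal. $R$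 is called domain-like if its zero ideal is prime. For a subgroup $H\le G$, let $\mathrm{Res}_H^G R$ be the $H$-Tambara functor $X\mapsto R(G\times_H X)$, and for an $H$-Tambara functor $S$ let $\mathrm{CoInd}_H^G S$ be the $G$-Tambara functor $X\mapsto S(X|_H)$. The $H$-th stratum of $\mathrm{Spec}(R)$ is the image of the map $\mathrm{Spec}(\mathrm{Res}_H^G R)\to\mathrm{Spec}(R)$ that sends $\mathfrak q$ to the contraction of $\mathrm{CoInd}_H^G\mathfrak q$ along the adjunction unit $R\to\mathrm{CoInd}_H^G\mathrm{Res}_H^G R$, which at level $X$ is the restriction along $G\times_H X\to X$, $[g,x]\mapsto gx$. Suppose that $R$ is domain-like and that $H\le G$ is a subgroup for which the restriction $R(G/G)\to R(G/H)$ is not injective. Then the $H$-th stratum is not an open subset of $\mathrm{Spec}(R)$. -/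

import Mathlib

universe u v w

/-- A finite (left) `G`-set. Morphisms are Mathlib's equivariant maps `X →[G] Y`. -/
structure FinGSet (G : Type u) [Group G] where
  carrier : Type u
  [action : MulAction G carrier]
  [finite : Finite carrier]

namespace FinGSet

instance (G : Type u) [Group G] : CoeSort (FinGSet G) (Type u) := ⟨FinGSet.carrier⟩

attribute [instance] FinGSet.action FinGSet.finite

section Diagrams

variable {G : Type u} [Group G] {X Y Z W A E Q : FinGSet G}

/-- The square with `p : W → X`, `q : W → Y`, `f : X → Z`, `g : Y → Z` is a pullback of `G`-sets. -/
structure IsPullbackSquare (p : W →[G] X) (q : W →[G] Y) (f : X →[G] Z) (g : Y →[G] Z) : Prop where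
  comm : ∀ t, f (p t) = g (q t)
  existsUnique : ∀ x y, f x = g y → ∃! t, p t = x ∧ q t = y

/-- `i : X → Z` and `j : Y → Z` exhibit `Z` as the disjoint union of `X` and `Y`. -/
def IsDisjointUnion (i : X →[G] Z) (j : Y →[G] Z) : Prop :=
  Function.Bijective (Sum.elim i j : X ⊕ Y → Z)

/-- The diagram `X ←p- A ←e- E -f'→ Q -q→ Y` is an exponential diagram for `f : X → Y` and
`p : A → X`. That is, `Q` is the dependent product `Π_f A`, whose points over `y : Y` are the
sections `s : f⁻¹(y) → A` of `p`, the square on `E` is the pullback `E = X ×_Y Q`, and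
`e : E → A` is the evaluation `(x, s) ↦ s x`. -/
structure IsExponentialDiagram (f : X →[G] Y) (p : A →[G] X)
    (e : E →[G] A) (f' : E →[G] Q) (q : Q →[G] Y) : Prop where
  isPullback : IsPullbackSquare (p.comp e) f' f q
  existsUnique : ∀ (y : Y) (s : {x : X // f x = y} → A), (∀ x, p (s x) = x) →
    ∃! z : Q, q z = y ∧
      ∀ (t : E) (x : {x : X // f x = y}), f' t = z → p (e t) = x → e t = s x

end Diagrams

/-- The transitive `G`-set `G/K`. -/
def orbit {G : Type u} [Group G] [Finite G] (K : Subgroup G) : FinGSet G := ⟨G ⧸ K⟩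

/-- The projection `G/K → G/L`, `gK ↦ gL`, for `K ≤ L`. -/
def orbitMap {G : Type u} [Group G] [Finite G] {K L : Subgroup G} (h : K ≤ L) :
    (orbit K : FinGSet G) →[G] (orbit L : FinGSet G) where
  toFun := Subgroup.quotientMapOfLE h
  map_smul' g x := by
    induction x using QuotientGroup.induction_on with
    | H a => rfl

section Restriction

variable {G : Type u} [Group G] (H : Subgroup G)

/-- A finite `G`-set regarded as an `H`-set. -/
def restrict (X : FinGSet G) : FinGSet H := ⟨X.carrier⟩

variable {X Y : FinGSet G}

/-- A `G`-map regarded as an `H`-map. -/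
def restrictMap (f : X →[G] Y) : (restrict H X) →[H] (restrict H Y) where
  toFun := f
  map_smul' h x := map_smul f (h : G) (show X from x)

end Restriction

section Induction

variable {G : Type u} [Group G] (H : Subgroup G)

/-- The relation `(g, x) ∼ (g h⁻¹, h x)`, for `h` in `H`, on `G × X`. -/
def indSetoid (X : FinGSet H) : Setoid (G × X) where
  r a b := ∃ h : H, b.1 = a.1 * (h : G)⁻¹ ∧ b.2 = h • a.2
  iseqv :=
    { refl := fun a => ⟨1, by simp, by simp⟩
      symm := by
        rintro ⟨a, x⟩ ⟨b, y⟩ ⟨h, h1, h2⟩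
        refine ⟨h⁻¹, ?_, ?_⟩
        · simp only at h1; simp [h1]
        · simp only at h2; simp [h2]
      trans := by
        rintro ⟨a, x⟩ ⟨b, y⟩ ⟨c, z⟩ ⟨h, h1, h2⟩ ⟨k, k1, k2⟩
        refine ⟨k * h, ?_, ?_⟩
        · simp only at h1 k1; simp [h1, k1, mul_assoc]
        · simp only at h2 k2; simp [h2, k2, mul_smul] }

instance indAction (X : FinGSet H) : MulAction G (Quotient (indSetoid H X)) where
  smul g := Quotient.map (fun a => (g * a.1, a.2)) (by
    rintro ⟨a, x⟩ ⟨b, y⟩ ⟨h, h1, h2⟩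
    exact ⟨h, by simp only at h1; simp [h1, mul_assoc], h2⟩)
  one_smul z := by
    induction z using Quotient.inductionOn with
    | h a => exact congrArg (Quotient.mk _) (by simp)
  mul_smul g g' z := by
    induction z using Quotient.inductionOn with
    | h a => exact congrArg (Quotient.mk _) (by simp [mul_assoc])

variable [Finite G]

/-- The induced `G`-set `G ×_H X`. -/
def induce (X : FinGSet H) : FinGSet G := ⟨Quotient (indSetoid H X)⟩

variable {H}

/-- The class `[g, x]` in `G ×_H X`. -/
def indMk {X : FinGSet H} (g : G) (x : X) : induce H X := Quotient.mk (indSetoid H X) (g, x)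

variable {X Y Z W A E Q : FinGSet H}

theorem indMk_surj (z : induce H X) : ∃ (g : G) (x : X), z = indMk g x := by
  induction z using Quotient.inductionOn with
  | h a => exact ⟨a.1, a.2, rfl⟩

theorem indMk_eq {g g' : G} {x x' : X} :
    (indMk g x : induce H X) = indMk g' x' ↔ ∃ h : H, g' = g * (h : G)⁻¹ ∧ x' = h • x :=
  Quotient.eq (r := indSetoid H X)

theorem smul_indMk (g g' : G) (x : X) : g • (indMk g' x : induce H X) = indMk (g * g') x := rfl

theorem indMk_inj {g : G} {x x' : X} (h : (indMk g x : induce H X) = indMk g x') : x = x' := by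
  obtain ⟨h, h1, h2⟩ := indMk_eq.1 h
  have : h = 1 := by simpa using h1
  simpa [this] using h2.symm

variable (H) in
/-- The induced map `G ×_H X → G ×_H Y`, `[g, x] ↦ [g, f x]`. -/
def induceMap (f : X →[H] Y) : (induce H X) →[G] (induce H Y) where
  toFun := Quotient.map (fun a => (a.1, f a.2)) (by
    rintro ⟨a, x⟩ ⟨b, y⟩ ⟨h, h1, h2⟩
    exact ⟨h, h1, by simp only at h2; simp [h2]⟩)
  map_smul' g z := by
    induction z using Quotient.inductionOn with
    | h a => rfl

@[simp] theorem induceMap_mk (f : X →[H] Y) (g : G) (x : X) :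
    induceMap H f (indMk g x) = indMk g (f x) := rfl

theorem induceMap_id : induceMap H (MulActionHom.id H : X →[H] X) = MulActionHom.id G := by
  ext z
  obtain ⟨g, x, rfl⟩ := indMk_surj z
  rfl

theorem induceMap_comp (f : X →[H] Y) (k : Y →[H] Z) :
    induceMap H (k.comp f) = (induceMap H k).comp (induceMap H f) := by
  ext z
  obtain ⟨g, x, rfl⟩ := indMk_surj z
  rfl

theorem induceMap_lift (f : X →[H] Y) {z : induce H X} {g : G} {y : Y}
    (h : induceMap H f z = indMk g y) : ∃ x, z = indMk g x ∧ f x = y := by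
  obtain ⟨a, x, rfl⟩ := indMk_surj z
  obtain ⟨k, k1, k2⟩ := indMk_eq.1 (by simpa using h)
  exact ⟨k • x, indMk_eq.2 ⟨k, k1, rfl⟩, by simp [k2]⟩

theorem IsPullbackSquare.induce {p : W →[H] X} {q : W →[H] Y} {f : X →[H] Z} {g : Y →[H] Z}
    (h : IsPullbackSquare p q f g) : IsPullbackSquare (induceMap H p) (induceMap H q)
      (induceMap H f) (induceMap H g) where
  comm t := by
    obtain ⟨a, t, rfl⟩ := indMk_surj t
    simp [h.comm]
  existsUnique x y hxy := by
    obtain ⟨a, x, rfl⟩ := indMk_surj x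
    obtain ⟨y, rfl, hy⟩ := induceMap_lift g (hxy.symm.trans (induceMap_mk f a x))
    obtain ⟨t, ⟨h1, h2⟩, h3⟩ := h.existsUnique x y hy.symm
    refine ⟨indMk a t, ⟨by simp [h1], by simp [h2]⟩, ?_⟩
    rintro t' ⟨h4, h5⟩
    obtain ⟨t', rfl, h6⟩ := induceMap_lift p h4
    rw [h3 t' ⟨h6, indMk_inj h5⟩]

theorem IsDisjointUnion.induce {i : X →[H] Z} {j : Y →[H] Z} (h : IsDisjointUnion i j) :
    IsDisjointUnion (induceMap H i) (induceMap H j) := by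
  have key : ∀ a b, Sum.elim i j a = Sum.elim i j b → a = b := fun a b hab => h.1 hab
  constructor
  · rintro (a | a) (b | b) hab
    · obtain ⟨g, x, rfl⟩ := indMk_surj b
      obtain ⟨y, rfl, hy⟩ := induceMap_lift i hab
      have := key (.inl y) (.inl x) hy
      simp_all
    · obtain ⟨g, x, rfl⟩ := indMk_surj b
      obtain ⟨y, rfl, hy⟩ := induceMap_lift i hab
      have := key (.inl y) (.inr x) hy
      simp_all
    · obtain ⟨g, x, rfl⟩ := indMk_surj b
      obtain ⟨y, rfl, hy⟩ := induceMap_lift j hab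
      have := key (.inr y) (.inl x) hy
      simp_all
    · obtain ⟨g, x, rfl⟩ := indMk_surj b
      obtain ⟨y, rfl, hy⟩ := induceMap_lift j hab
      have := key (.inr y) (.inr x) hy
      simp_all
  · intro z
    obtain ⟨g, z, rfl⟩ := indMk_surj z
    obtain ⟨a | a, rfl⟩ := h.2 z
    · exact ⟨.inl (indMk g a), rfl⟩
    · exact ⟨.inr (indMk g a), rfl⟩

theorem IsExponentialDiagram.induce {f : X →[H] Y} {p : A →[H] X}
    {e : E →[H] A} {f' : E →[H] Q} {q : Q →[H] Y} (h : IsExponentialDiagram f p e f' q) :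
    IsExponentialDiagram (induceMap H f) (induceMap H p) (induceMap H e) (induceMap H f')
      (induceMap H q) where
  isPullback := by
    rw [← induceMap_comp]
    exact h.isPullback.induce
  existsUnique y s hs := by
    obtain ⟨a, y, rfl⟩ := indMk_surj y
    have h0 : ∀ x : {x : X // f x = y}, ∃ b : A,
        s ⟨indMk a x.1, by simp [x.2]⟩ = indMk a b ∧ p b = x.1 := fun x =>
      induceMap_lift p (hs ⟨indMk a x.1, by simp [x.2]⟩)
    choose s₀ hs₀ hp₀ using h0
    obtain ⟨z, ⟨hz, hz'⟩, huniq⟩ := h.existsUnique y s₀ hp₀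
    refine ⟨indMk a z, ⟨by simp [hz], ?_⟩, ?_⟩
    · rintro t ⟨x, hx⟩ ht hpt
      obtain ⟨t, rfl, ht'⟩ := induceMap_lift f' ht
      simp only [induceMap_mk] at hpt
      subst hpt
      have hx' : f (p (e t)) = y := indMk_inj hx
      exact (congrArg (indMk a) (hz' t ⟨p (e t), hx'⟩ ht' rfl)).trans (hs₀ ⟨p (e t), hx'⟩).symm
    · rintro z' ⟨h1, h2⟩
      obtain ⟨z', rfl, hz₁⟩ := induceMap_lift q h1
      rw [huniq z' ⟨hz₁, ?_⟩]
      rintro t x ht hpt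
      have := h2 (indMk a t) ⟨indMk a x.1, by simp [x.2]⟩ (by simp [ht]) (by simp [hpt])
      rw [hs₀ x] at this
      exact indMk_inj this

variable (H) in
/-- The action map `G ×_H X → X`, `[g, x] ↦ g x`, for a `G`-set `X`. -/
def actMap (X : FinGSet G) : (induce H (restrict H X)) →[G] X where
  toFun := Quotient.lift (fun a : G × restrict H X => a.1 • (show X from a.2)) (by
    rintro ⟨a, x⟩ ⟨b, y⟩ ⟨h, h1, h2⟩
    simp only at h1 h2
    subst h1 h2
    change a • (show X from x) = (a * (h : G)⁻¹) • ((h : G) • (show X from x))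
    rw [smul_smul, inv_mul_cancel_right])
  map_smul' g z := by
    induction z using Quotient.inductionOn with
    | h a => exact mul_smul g a.1 (show X from a.2)

@[simp] theorem actMap_mk (X : FinGSet G) (g : G) (x : X) :
    actMap H X (indMk (X := restrict H X) g x) = g • x := rfl

theorem actMap_isPullback {X Y : FinGSet G} (f : X →[G] Y) :
    IsPullbackSquare (actMap H X) (induceMap H (restrictMap H f)) f (actMap H Y) where
  comm t := by
    obtain ⟨a, (t : X), rfl⟩ := indMk_surj t
    exact map_smul f a t
  existsUnique x y hxy := by
    obtain ⟨a, (y : Y), rfl⟩ := indMk_surj y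
    have hy : f x = a • y := hxy
    refine ⟨indMk (X := restrict H X) a (a⁻¹ • x : X), ⟨?_, ?_⟩, ?_⟩
    · simp
    · change indMk (X := restrict H Y) a (f (a⁻¹ • x)) = _
      rw [map_smul, hy, inv_smul_smul]
    · rintro t ⟨h1, h2⟩
      obtain ⟨t, rfl, -⟩ := induceMap_lift (restrictMap H f) h2
      have : a • (show X from t) = x := h1
      rw [← this, inv_smul_smul]

end Induction

end FinGSet

section Tambara

open FinGSet

/-- A `G`-Tambara functor: commutative rings `R(X)` for all finite `G`-sets `X`, with restrictions
`f^*`, transfers `f_+` and norms `f_•` along all maps `f` of finite `G`-sets. All three are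
functorial, `R` takes disjoint unions to products, transfers and norms satisfy the base change
formula for pullback squares, and `f_• p_+ = q_+ f'_• e^*` for every exponential diagram. -/
structure TambaraFunctor (G : Type u) [Group G] where
  obj : FinGSet G → Type v
  [ring : ∀ X, CommRing (obj X)]
  res : ∀ {X Y : FinGSet G}, (X →[G] Y) → (obj Y →+* obj X)
  tr : ∀ {X Y : FinGSet G}, (X →[G] Y) → (obj X →+ obj Y)
  nm : ∀ {X Y : FinGSet G}, (X →[G] Y) → (obj X →* obj Y)
  res_id : ∀ {X : FinGSet G} (a : obj X), res (MulActionHom.id G) a = a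
  res_comp : ∀ {X Y Z : FinGSet G} (f : X →[G] Y) (g : Y →[G] Z) (a : obj Z),
    res (g.comp f) a = res f (res g a)
  tr_id : ∀ {X : FinGSet G} (a : obj X), tr (MulActionHom.id G) a = a
  tr_comp : ∀ {X Y Z : FinGSet G} (f : X →[G] Y) (g : Y →[G] Z) (a : obj X),
    tr (g.comp f) a = tr g (tr f a)
  nm_id : ∀ {X : FinGSet G} (a : obj X), nm (MulActionHom.id G) a = a
  nm_comp : ∀ {X Y Z : FinGSet G} (f : X →[G] Y) (g : Y →[G] Z) (a : obj X),
    nm (g.comp f) a = nm g (nm f a)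
  subsingleton_of_isEmpty : ∀ (X : FinGSet G), IsEmpty X → Subsingleton (obj X)
  bijective_of_isDisjointUnion : ∀ {X Y Z : FinGSet G} (i : X →[G] Z) (j : Y →[G] Z),
    IsDisjointUnion i j → Function.Bijective fun a : obj Z => (res i a, res j a)
  res_tr : ∀ {W X Y Z : FinGSet G} (p : W →[G] X) (q : W →[G] Y) (f : X →[G] Z) (g : Y →[G] Z),
    IsPullbackSquare p q f g → ∀ a : obj X, res g (tr f a) = tr q (res p a)
  res_nm : ∀ {W X Y Z : FinGSet G} (p : W →[G] X) (q : W →[G] Y) (f : X →[G] Z) (g : Y →[G] Z),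
    IsPullbackSquare p q f g → ∀ a : obj X, res g (nm f a) = nm q (res p a)
  nm_tr : ∀ {X Y A E Q : FinGSet G} (f : X →[G] Y) (p : A →[G] X) (e : E →[G] A)
    (f' : E →[G] Q) (q : Q →[G] Y), IsExponentialDiagram f p e f' q →
    ∀ a : obj A, nm f (tr p a) = tr q (nm f' (res e a))

namespace TambaraFunctor

attribute [instance] TambaraFunctor.ring

/-- A morphism of Tambara functors. -/
structure Hom {G : Type u} [Group G] (R : TambaraFunctor.{u, v} G)
    (S : TambaraFunctor.{u, w} G) where
  app : ∀ X : FinGSet G, R.obj X →+* S.obj X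
  app_res : ∀ {X Y : FinGSet G} (f : X →[G] Y) (a : R.obj Y),
    app X (R.res f a) = S.res f (app Y a)
  app_tr : ∀ {X Y : FinGSet G} (f : X →[G] Y) (a : R.obj X),
    app Y (R.tr f a) = S.tr f (app X a)
  app_nm : ∀ {X Y : FinGSet G} (f : X →[G] Y) (a : R.obj X),
    app Y (R.nm f a) = S.nm f (app X a)

/-- A Tambara ideal. For `f` surjective `f_•(0) = 0`, so that the condition on norms reads
`f_•(I(X)) ⊆ I(Y)`. -/
@[ext] structure TambaraIdeal {G : Type u} [Group G] (R : TambaraFunctor.{u, v} G) where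
  carrier : ∀ X : FinGSet G, Ideal (R.obj X)
  res_mem : ∀ {X Y : FinGSet G} (f : X →[G] Y) {a : R.obj Y},
    a ∈ carrier Y → R.res f a ∈ carrier X
  tr_mem : ∀ {X Y : FinGSet G} (f : X →[G] Y) {a : R.obj X},
    a ∈ carrier X → R.tr f a ∈ carrier Y
  nm_mem : ∀ {X Y : FinGSet G} (f : X →[G] Y) {a : R.obj X},
    a ∈ carrier X → R.nm f a - R.nm f 0 ∈ carrier Y

namespace TambaraIdeal

variable {G : Type u} [Group G] {R : TambaraFunctor.{u, v} G}

/-- Levelwise inclusion. -/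
instance : PartialOrder (TambaraIdeal R) :=
  PartialOrder.lift TambaraIdeal.carrier fun _ _ h => TambaraIdeal.ext h

/-- The zero ideal. -/
instance : Bot (TambaraIdeal R) where
  bot :=
    { carrier := fun _ => ⊥
      res_mem := fun f a ha => by
        rw [Ideal.mem_bot] at ha ⊢
        rw [ha, map_zero]
      tr_mem := fun f a ha => by
        rw [Ideal.mem_bot] at ha ⊢
        rw [ha, map_zero]
      nm_mem := fun f a ha => by
        rw [Ideal.mem_bot] at ha ⊢
        rw [ha, sub_self] }

/-- The ideal `R` itself. -/
instance : Top (TambaraIdeal R) where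
  top :=
    { carrier := fun _ => ⊤
      res_mem := fun _ _ _ => Submodule.mem_top
      tr_mem := fun _ _ _ => Submodule.mem_top
      nm_mem := fun _ _ _ => Submodule.mem_top }

/-- The Tambara ideal generated by a family of sets: the intersection of all Tambara ideals that
contain it. -/
def span (S : ∀ X : FinGSet G, Set (R.obj X)) : TambaraIdeal R where
  carrier X := ⨅ I : {I : TambaraIdeal R // ∀ Y, S Y ⊆ I.carrier Y}, I.1.carrier X
  res_mem f a ha := by
    rw [Ideal.mem_iInf] at ha ⊢
    exact fun I => I.1.res_mem f (ha I)
  tr_mem f a ha := by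
    rw [Ideal.mem_iInf] at ha ⊢
    exact fun I => I.1.tr_mem f (ha I)
  nm_mem f a ha := by
    rw [Ideal.mem_iInf] at ha ⊢
    exact fun I => I.1.nm_mem f (ha I)

/-- The product of two Tambara ideals: the Tambara ideal generated by the levelwise products. -/
instance : Mul (TambaraIdeal R) where
  mul I J := span fun X => {c | ∃ a ∈ I.carrier X, ∃ b ∈ J.carrier X, c = a * b}

/-- Prime Tambara ideals. -/
def IsPrime (P : TambaraIdeal R) : Prop :=
  P ≠ ⊤ ∧ ∀ I J : TambaraIdeal R, I * J ≤ P → I ≤ P ∨ J ≤ P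

/-- The contraction of a Tambara ideal along a morphism of Tambara functors. -/
def comap {S : TambaraFunctor.{u, w} G} (φ : Hom R S) (I : TambaraIdeal S) : TambaraIdeal R where
  carrier X := (I.carrier X).comap (φ.app X)
  res_mem f a ha := by
    rw [Ideal.mem_comap] at ha ⊢
    rw [φ.app_res]
    exact I.res_mem f ha
  tr_mem f a ha := by
    rw [Ideal.mem_comap] at ha ⊢
    rw [φ.app_tr]
    exact I.tr_mem f ha
  nm_mem f a ha := by
    rw [Ideal.mem_comap] at ha ⊢
    rw [map_sub, φ.app_nm, φ.app_nm, map_zero]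
    exact I.nm_mem f ha

end TambaraIdeal

section ChangeOfGroup

variable {G : Type u} [Group G]

/-- The restriction `Res_H^G R`, given by `X ↦ R(G ×_H X)`. In particular its value at `H/K` is
`R(G/K)`. -/
def resFunctor [Finite G] (R : TambaraFunctor.{u, v} G) (H : Subgroup G) :
    TambaraFunctor.{u, v} H where
  obj X := R.obj (induce H X)
  ring X := R.ring (induce H X)
  res f := R.res (induceMap H f)
  tr f := R.tr (induceMap H f)
  nm f := R.nm (induceMap H f)
  res_id a := by rw [induceMap_id, R.res_id]
  res_comp f g a := by rw [induceMap_comp, R.res_comp]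
  tr_id a := by rw [induceMap_id, R.tr_id]
  tr_comp f g a := by rw [induceMap_comp, R.tr_comp]
  nm_id a := by rw [induceMap_id, R.nm_id]
  nm_comp f g a := by rw [induceMap_comp, R.nm_comp]
  subsingleton_of_isEmpty X hX := R.subsingleton_of_isEmpty _
    ⟨fun z => by obtain ⟨_, x, -⟩ := indMk_surj z; exact hX.elim x⟩
  bijective_of_isDisjointUnion i j h := R.bijective_of_isDisjointUnion _ _ h.induce
  res_tr p q f g h := R.res_tr _ _ _ _ h.induce
  res_nm p q f g h := R.res_nm _ _ _ _ h.induce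
  nm_tr f p e f' q h := R.nm_tr _ _ _ _ _ h.induce

/-- The coinduction `CoInd_H^G S`, given by `X ↦ S(X)` with `X` regarded as an `H`-set. -/
def coindFunctor (H : Subgroup G) (S : TambaraFunctor.{u, v} H) : TambaraFunctor.{u, v} G where
  obj X := S.obj (restrict H X)
  ring X := S.ring (restrict H X)
  res f := S.res (restrictMap H f)
  tr f := S.tr (restrictMap H f)
  nm f := S.nm (restrictMap H f)
  res_id a := S.res_id a
  res_comp f g a := S.res_comp (restrictMap H f) (restrictMap H g) a
  tr_id a := S.tr_id a
  tr_comp f g a := S.tr_comp (restrictMap H f) (restrictMap H g) a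
  nm_id a := S.nm_id a
  nm_comp f g a := S.nm_comp (restrictMap H f) (restrictMap H g) a
  subsingleton_of_isEmpty X hX := S.subsingleton_of_isEmpty (restrict H X) hX
  bijective_of_isDisjointUnion i j h := S.bijective_of_isDisjointUnion _ _ h
  res_tr p q f g h := S.res_tr _ _ _ _ ⟨h.1, h.2⟩
  res_nm p q f g h := S.res_nm _ _ _ _ ⟨h.1, h.2⟩
  nm_tr f p e f' q h := S.nm_tr _ _ _ _ _ ⟨⟨h.1.1, h.1.2⟩, h.2⟩

/-- The coinduction of a Tambara ideal. -/
def TambaraIdeal.coind {H : Subgroup G} {S : TambaraFunctor.{u, v} H} (I : TambaraIdeal S) :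
    TambaraIdeal (coindFunctor H S) where
  carrier X := I.carrier (restrict H X)
  res_mem f _ ha := I.res_mem (restrictMap H f) ha
  tr_mem f _ ha := I.tr_mem (restrictMap H f) ha
  nm_mem f _ ha := I.nm_mem (restrictMap H f) ha

/-- The unit `R → CoInd_H^G Res_H^G R` of the adjunction between restriction and coinduction. At
level `X` it is the restriction of `R` along the action map `G ×_H X → X`. -/
def coindUnit [Finite G] (R : TambaraFunctor.{u, v} G) (H : Subgroup G) :
    Hom R (coindFunctor H (R.resFunctor H)) where
  app X := R.res (actMap H X)
  app_res {X Y} f a := by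
    change R.res (actMap H X) (R.res f a) =
      R.res (induceMap H (restrictMap H f)) (R.res (actMap H Y) a)
    rw [← R.res_comp, ← R.res_comp]
    congr 2
    ext t
    exact (actMap_isPullback f).comm t
  app_tr f a := R.res_tr _ _ _ _ (actMap_isPullback f) a
  app_nm f a := R.res_nm _ _ _ _ (actMap_isPullback f) a

end ChangeOfGroup

section Spectrum

variable {G : Type u} [Group G]

/-- The Nakaoka spectrum of `R`: the set of prime Tambara ideals. -/
def Spec (R : TambaraFunctor.{u, v} G) : Type (max (u + 1) v) :=
  {P : TambaraIdeal R // P.IsPrime}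

/-- The set `V(I)` of all prime ideals that contain `I`. -/
def zeroLocus {R : TambaraFunctor.{u, v} G} (I : TambaraIdeal R) : Set R.Spec := {P | I ≤ P.1}

/-- The topology whose closed sets are generated by the sets `V(I)`. -/
instance (R : TambaraFunctor.{u, v} G) : TopologicalSpace R.Spec :=
  TopologicalSpace.generateFrom {U | ∃ I : TambaraIdeal R, U = (zeroLocus I)ᶜ}

/-- The zero ideal is prime. -/
def IsDomainLike (R : TambaraFunctor.{u, v} G) : Prop := (⊥ : TambaraIdeal R).IsPrime

/-- The `H`-th stratum of `Spec R`: the image of `Spec (Res_H^G R) → Spec R`, the map that sends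
`Q` to the contraction, along the unit `R → CoInd_H^G Res_H^G R`, of the coinduction of `Q`. -/
def stratum [Finite G] (R : TambaraFunctor.{u, v} G) (H : Subgroup G) : Set R.Spec :=
  {P | ∃ Q : (R.resFunctor H).Spec, P.1 = Q.1.coind.comap (R.coindUnit H)}

end Spectrum

end TambaraFunctor

end Tambara

/-!
Every nonempty open subset of `Spec R` is stable under generization, so if `R` is domain-like it
contains the zero ideal. On the other hand `Res_H^G` on ideals is left adjoint to the contraction
`𝔮 ↦ η⁻¹(CoInd_H^G 𝔮)` along the unit `η : R → CoInd_H^G Res_H^G R`, and it follows that a prime in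
the `H`-th stratum contains `a ∈ R(X)` as soon as it contains the restriction of `a` along
`G ×_H X → X`. If the zero ideal lies in the stratum, these restrictions are therefore injective;
for `X = G/G` the action map factors through `G/H`.

The stratum is nonempty because a nonzero Tambara functor has a prime ideal. Contracting from the
trivial subgroup reduces this to the trivial group, where a prime ideal of the ring at the point
gives the prime Tambara ideal of all elements whose value at each point lies in it.
-/

namespace FinGSet

variable {G : Type u} [Group G] {W X Y Z : FinGSet G}

/-- The empty `G`-set. -/
def empty (G : Type u) [Group G] : FinGSet G where
  carrier := PEmpty
  action := { smul _ x := x, one_smul x := x.elim, mul_smul _ _ x := x.elim }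

instance : IsEmpty (empty G) := inferInstanceAs (IsEmpty PEmpty)

/-- The unique equivariant map out of an empty `G`-set. -/
def ofIsEmpty (X Y : FinGSet G) [IsEmpty X] : X →[G] Y where
  toFun := isEmptyElim
  map_smul' _ := isEmptyElim

/-- The one-point `G`-set. -/
def point (G : Type u) [Group G] : FinGSet G := ⟨PUnit⟩

instance : Unique (point G) := inferInstanceAs (Unique PUnit)

/-- The unique equivariant map to the one-point `G`-set. -/
def toPoint (X : FinGSet G) : X →[G] point G where
  toFun _ := default
  map_smul' _ _ := rfl

/-- A `G`-stable subset of a finite `G`-set. -/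
def ofSubMulAction (S : SubMulAction G X) : FinGSet G := ⟨S⟩

/-- The inclusion of a `G`-stable subset. -/
def subtypeHom (S : SubMulAction G X) : ofSubMulAction S →[G] X := S.inclusion

/-- The orbit of a point, as a `G`-stable subset. -/
def orbitOf (x : X) : SubMulAction G X where
  carrier := MulAction.orbit G x
  smul_mem' g _ := MulAction.mem_orbit_of_mem_orbit g

theorem isDisjointUnion_compl (S : SubMulAction G X) :
    IsDisjointUnion (subtypeHom S) (subtypeHom Sᶜ) := by
  classical
  exact (Equiv.Set.sumCompl (S : Set X)).bijective

theorem isPullbackSquare_of_injective {i : X →[G] Y} (hi : Function.Injective i) :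
    IsPullbackSquare (MulActionHom.id G) (MulActionHom.id G) i i where
  comm _ := rfl
  existsUnique x _ h := ⟨x, ⟨rfl, hi h⟩, fun _ h' => h'.1⟩

theorem isPullbackSquare_of_isEmpty [IsEmpty W] {f : X →[G] Z} {g : Y →[G] Z}
    (h : ∀ x y, f x ≠ g y) : IsPullbackSquare (ofIsEmpty W X) (ofIsEmpty W Y) f g where
  comm := isEmptyElim
  existsUnique x y hxy := (h x y hxy).elim

theorem isExponentialDiagram_of_surjective [IsEmpty W] {f : X →[G] Y}
    (hf : Function.Surjective f) :
    IsExponentialDiagram f (ofIsEmpty W X) (MulActionHom.id G) (MulActionHom.id G)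
      (ofIsEmpty W Y) where
  isPullback := ⟨isEmptyElim, fun _ => isEmptyElim⟩
  existsUnique y s _ := (hf y).elim fun x hx => isEmptyElim (s ⟨x, hx⟩)

namespace IsDisjointUnion

variable {i : X →[G] Z} {j : Y →[G] Z}

theorem injective_left (h : IsDisjointUnion i j) : Function.Injective i :=
  (Sum.elim_injective.1 h.1).1

theorem injective_right (h : IsDisjointUnion i j) : Function.Injective j :=
  (Sum.elim_injective.1 h.1).2.1

theorem ne (h : IsDisjointUnion i j) (x : X) (y : Y) : i x ≠ j y :=
  (Sum.elim_injective.1 h.1).2.2 x y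

end IsDisjointUnion

theorem induction_on_orbits {motive : FinGSet G → Prop}
    (of_isEmpty : ∀ X : FinGSet G, IsEmpty X → motive X)
    (of_isDisjointUnion : ∀ {X Y Z : FinGSet G} (i : X →[G] Z) (j : Y →[G] Z),
      IsDisjointUnion i j → Nonempty X → MulAction.IsPretransitive G X → motive Y → motive Z)
    (Z : FinGSet G) : motive Z := by
  induction hn : Nat.card Z using Nat.strong_induction_on generalizing Z with
  | _ n ih =>
    rcases isEmpty_or_nonempty Z with hZ | ⟨⟨z⟩⟩
    · exact of_isEmpty Z hZ
    have hz : z ∉ (orbitOf z)ᶜ := not_not.2 (MulAction.mem_orbit_self z)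
    have hcard : Nat.card (ofSubMulAction (orbitOf z)ᶜ) < n := hn ▸ Finite.card_subtype_lt hz
    exact of_isDisjointUnion _ _ (isDisjointUnion_compl (orbitOf z))
      ⟨⟨z, MulAction.mem_orbit_self z⟩⟩
      (inferInstanceAs (MulAction.IsPretransitive G (MulAction.orbit G z))) (ih _ hcard _ rfl)

section TrivialGroup

variable [Subsingleton G]

theorem injective_of_isPretransitive [MulAction.IsPretransitive G X] (f : X →[G] Y) :
    Function.Injective f := fun x x' _ => by
  obtain ⟨g, rfl⟩ := MulAction.exists_smul_eq G x x'
  rw [Subsingleton.elim g 1, one_smul]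

theorem exists_comp_eq_or_forall_ne (f : X →[G] Y) (y : point G →[G] Y) :
    (∃ x : point G →[G] X, f.comp x = y) ∨ ∀ x t, f x ≠ y t := by
  by_cases h : ∃ x, f x = y default
  · obtain ⟨x, hx⟩ := h
    let toX : point G →[G] X := ⟨fun _ => x, fun g _ => by rw [Subsingleton.elim g 1]; simp⟩
    exact .inl ⟨toX, DFunLike.ext _ _ fun t => Subsingleton.elim default t ▸ hx⟩
  · exact .inr fun x t hx => h ⟨x, Subsingleton.elim t default ▸ hx⟩

end TrivialGroup

section Induction

variable [Finite G] {H : Subgroup G}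

instance (Y : FinGSet H) [hY : Nonempty Y] : Nonempty (induce H Y) :=
  hY.map (indMk 1)

/-- The unit `Y → (G ×_H Y)|_H`, `y ↦ [1, y]`, of the adjunction between induction and
restriction. -/
def indUnit (Y : FinGSet H) : Y →[H] restrict H (induce H Y) where
  toFun y := indMk (1 : G) y
  map_smul' h y := indMk_eq.2 ⟨h⁻¹, by simp, by simp⟩

theorem actMap_comp_induceMap_indUnit (Y : FinGSet H) :
    (actMap H (induce H Y)).comp (induceMap H (indUnit Y)) = MulActionHom.id G := by
  ext z
  obtain ⟨g, y, rfl⟩ := indMk_surj z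
  change g • (indMk (1 : G) y : induce H Y) = indMk g y
  rw [smul_indMk, mul_one]

/-- The projection `G ×_H X → G/H`, `[g, x] ↦ gH`. -/
def indProj (H : Subgroup G) (X : FinGSet H) : induce H X →[G] orbit H where
  toFun := Quotient.lift (fun a : G × X => (QuotientGroup.mk a.1 : G ⧸ H)) (by
    rintro ⟨a, x⟩ ⟨_, y⟩ ⟨h, rfl, -⟩
    exact QuotientGroup.eq.2 (by simp))
  map_smul' g z := by
    obtain ⟨a, x, rfl⟩ := indMk_surj z
    rfl

theorem actMap_orbit_top (H : Subgroup G) :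
    actMap H (orbit ⊤) = (orbitMap le_top).comp (indProj H (restrict H (orbit ⊤))) := by
  ext z
  exact (QuotientGroup.subsingleton_quotient_top (G := G)).elim _ _

end Induction

end FinGSet

namespace TambaraFunctor

open FinGSet
open scoped Topology

section Basic

variable {G : Type u} [Group G] (R : TambaraFunctor.{u, v} G) {X Y Z : FinGSet G}

theorem res_tr_of_injective {i : X →[G] Y} (hi : Function.Injective i) (a : R.obj X) :
    R.res i (R.tr i a) = a := by
  rw [R.res_tr _ _ _ _ (isPullbackSquare_of_injective hi), R.res_id, R.tr_id]

theorem res_nm_of_injective {i : X →[G] Y} (hi : Function.Injective i) (a : R.obj X) :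
    R.res i (R.nm i a) = a := by
  rw [R.res_nm _ _ _ _ (isPullbackSquare_of_injective hi), R.res_id, R.nm_id]

instance : Subsingleton (R.obj (empty G)) := R.subsingleton_of_isEmpty _ inferInstance

theorem res_tr_eq_zero {f : X →[G] Z} {g : Y →[G] Z} (h : ∀ x y, f x ≠ g y) (a : R.obj X) :
    R.res g (R.tr f a) = 0 := by
  rw [R.res_tr _ _ _ _ (isPullbackSquare_of_isEmpty (W := empty G) h),
    Subsingleton.elim (R.res _ a) 0, map_zero]

theorem res_nm_eq_one {f : X →[G] Z} {g : Y →[G] Z} (h : ∀ x y, f x ≠ g y) (a : R.obj X) :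
    R.res g (R.nm f a) = 1 := by
  rw [R.res_nm _ _ _ _ (isPullbackSquare_of_isEmpty (W := empty G) h),
    Subsingleton.elim (R.res _ a) 1, map_one]

theorem tr_res_add_tr_res {i : X →[G] Z} {j : Y →[G] Z} (h : IsDisjointUnion i j)
    (c : R.obj Z) : R.tr i (R.res i c) + R.tr j (R.res j c) = c := by
  apply (R.bijective_of_isDisjointUnion i j h).1
  simp only [map_add, R.res_tr_of_injective h.injective_left,
    R.res_tr_of_injective h.injective_right, R.res_tr_eq_zero h.ne,
    R.res_tr_eq_zero fun y x => (h.ne x y).symm, add_zero, zero_add]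

theorem nm_res_mul_nm_res {i : X →[G] Z} {j : Y →[G] Z} (h : IsDisjointUnion i j)
    (c : R.obj Z) : R.nm i (R.res i c) * R.nm j (R.res j c) = c := by
  apply (R.bijective_of_isDisjointUnion i j h).1
  simp only [map_mul, R.res_nm_of_injective h.injective_left,
    R.res_nm_of_injective h.injective_right, R.res_nm_eq_one h.ne,
    R.res_nm_eq_one fun y x => (h.ne x y).symm, mul_one, one_mul]

theorem nm_zero_of_surjective {f : X →[G] Y} (hf : Function.Surjective f) : R.nm f 0 = 0 := by
  have h := R.nm_tr _ _ _ _ _ (isExponentialDiagram_of_surjective (W := empty G) hf) 0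
  rw [map_zero] at h
  rw [h, Subsingleton.elim (R.nm _ _) 0, map_zero]

theorem subsingleton_of_subsingleton_obj [Subsingleton (R.obj X)] [Nonempty X]
    (Y : FinGSet G) : Subsingleton (R.obj Y) := by
  have hX : Function.Surjective (toPoint X) := Function.surjective_to_subsingleton _
  have h_point : (1 : R.obj (point G)) = 0 := by
    rw [← map_one (R.nm (toPoint X)), Subsingleton.elim (1 : R.obj X) 0,
      R.nm_zero_of_surjective hX]
  refine subsingleton_of_zero_eq_one ?_
  rw [← map_one (R.res (toPoint Y)), h_point, map_zero]

instance (H : Subgroup G) [Finite G] [Nontrivial (R.obj (point G))] :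
    Nontrivial ((R.resFunctor H).obj (point H)) := by
  by_contra h
  have : Subsingleton (R.obj (induce H (point H))) := not_nontrivial_iff_subsingleton.1 h
  have := R.subsingleton_of_subsingleton_obj (X := induce H (point H)) (point G)
  exact not_subsingleton (R.obj (point G)) this

end Basic

namespace TambaraIdeal

section Lattice

variable {G : Type u} [Group G] {R : TambaraFunctor.{u, v} G}

instance : BoundedOrder (TambaraIdeal R) where
  bot_le I _ := bot_le (a := I.carrier _)
  le_top I _ := le_top (a := I.carrier _)

theorem mul_mem_mul {I J : TambaraIdeal R} {X : FinGSet G} {a b : R.obj X}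
    (ha : a ∈ I.carrier X) (hb : b ∈ J.carrier X) : a * b ∈ (I * J).carrier X :=
  Ideal.mem_iInf.2 fun K => K.2 X ⟨a, ha, b, hb, rfl⟩

theorem mul_le {I J K : TambaraIdeal R} :
    I * J ≤ K ↔ ∀ X, ∀ a ∈ I.carrier X, ∀ b ∈ J.carrier X, a * b ∈ K.carrier X := by
  refine ⟨fun h X a ha b hb => h X (mul_mem_mul ha hb), fun h X c hc =>
    Ideal.mem_iInf.1 hc ⟨K, fun Y => ?_⟩⟩
  rintro _ ⟨a, ha, b, hb, rfl⟩
  exact h Y a ha b hb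

end Lattice

section OfOrbits

variable {G : Type u} [Group G] {R : TambaraFunctor.{u, v} G} {𝓘 : ∀ X, Ideal (R.obj X)}

theorem tr_mem_of_orbits
    (res_mem : ∀ {X Y : FinGSet G} (f : X →[G] Y) {a : R.obj Y}, a ∈ 𝓘 Y → R.res f a ∈ 𝓘 X)
    (tr_mem : ∀ {X Y : FinGSet G} [Nonempty X] [MulAction.IsPretransitive G X] (f : X →[G] Y)
      {a : R.obj X}, a ∈ 𝓘 X → R.tr f a ∈ 𝓘 Y)
    {X Y : FinGSet G} (f : X →[G] Y) {a : R.obj X} (ha : a ∈ 𝓘 X) : R.tr f a ∈ 𝓘 Y := by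
  induction X using induction_on_orbits with
  | of_isEmpty X hX =>
    have := R.subsingleton_of_isEmpty X hX
    rw [Subsingleton.elim a 0, map_zero]
    exact zero_mem _
  | of_isDisjointUnion i j hij _ _ ih =>
    rw [← R.tr_res_add_tr_res hij a, map_add, ← R.tr_comp, ← R.tr_comp]
    exact add_mem (tr_mem _ (res_mem i ha)) (ih _ (res_mem j ha))

theorem nm_sub_nm_zero_mem_of_orbits
    (res_mem : ∀ {X Y : FinGSet G} (f : X →[G] Y) {a : R.obj Y}, a ∈ 𝓘 Y → R.res f a ∈ 𝓘 X)
    (nm_mem : ∀ {X Y : FinGSet G} [Nonempty X] [MulAction.IsPretransitive G X] (f : X →[G] Y)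
      {a : R.obj X}, a ∈ 𝓘 X → R.nm f a - R.nm f 0 ∈ 𝓘 Y)
    {X Y : FinGSet G} (f : X →[G] Y) {a : R.obj X} (ha : a ∈ 𝓘 X) :
    R.nm f a - R.nm f 0 ∈ 𝓘 Y := by
  induction X using induction_on_orbits with
  | of_isEmpty X hX =>
    have := R.subsingleton_of_isEmpty X hX
    rw [Subsingleton.elim a 0, sub_self]
    exact zero_mem _
  | of_isDisjointUnion i j hij _ _ ih =>
    have nm_eq_mul : ∀ c, R.nm f c =
        R.nm (f.comp i) (R.res i c) * R.nm (f.comp j) (R.res j c) := fun c => by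
      rw [R.nm_comp, R.nm_comp, ← map_mul, R.nm_res_mul_nm_res hij]
    rw [nm_eq_mul a, nm_eq_mul 0, map_zero (R.res i), map_zero (R.res j)]
    exact Ideal.mul_sub_mul_mem _ (nm_mem _ (res_mem i ha)) (ih _ (res_mem j ha))

end OfOrbits

section OfPoint

variable {G : Type u} [Group G] {R : TambaraFunctor.{u, v} G} {X Y : FinGSet G}
  (I : Ideal (R.obj (point G)))

/-- The ideal of `R(X)` of all elements whose values at the points of `X` lie in `I`. -/
def pointwiseIdeal (X : FinGSet G) : Ideal (R.obj X) :=
  ⨅ x : point G →[G] X, I.comap (R.res x)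

variable {I}

theorem mem_pointwiseIdeal {a : R.obj X} :
    a ∈ pointwiseIdeal I X ↔ ∀ x : point G →[G] X, R.res x a ∈ I := by
  simp only [pointwiseIdeal, Ideal.mem_iInf, Ideal.mem_comap]

theorem res_mem_pointwiseIdeal (f : X →[G] Y) {a : R.obj Y} (ha : a ∈ pointwiseIdeal I Y) :
    R.res f a ∈ pointwiseIdeal I X :=
  mem_pointwiseIdeal.2 fun x => R.res_comp x f a ▸ mem_pointwiseIdeal.1 ha _

variable [Subsingleton G]

theorem tr_mem_pointwiseIdeal {f : X →[G] Y} (hf : Function.Injective f) {a : R.obj X}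
    (ha : a ∈ pointwiseIdeal I X) : R.tr f a ∈ pointwiseIdeal I Y := by
  refine mem_pointwiseIdeal.2 fun y => ?_
  rcases exists_comp_eq_or_forall_ne f y with ⟨x, rfl⟩ | hy
  · rw [R.res_comp, R.res_tr_of_injective hf]
    exact mem_pointwiseIdeal.1 ha x
  · rw [R.res_tr_eq_zero hy]
    exact zero_mem I

theorem nm_sub_nm_zero_mem_pointwiseIdeal {f : X →[G] Y} (hf : Function.Injective f)
    {a : R.obj X} (ha : a ∈ pointwiseIdeal I X) :
    R.nm f a - R.nm f 0 ∈ pointwiseIdeal I Y := by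
  refine mem_pointwiseIdeal.2 fun y => ?_
  rw [map_sub]
  rcases exists_comp_eq_or_forall_ne f y with ⟨x, rfl⟩ | hy
  · rw [R.res_comp, R.res_comp, R.res_nm_of_injective hf, R.res_nm_of_injective hf, map_zero,
      sub_zero]
    exact mem_pointwiseIdeal.1 ha x
  · rw [R.res_nm_eq_one hy, R.res_nm_eq_one hy, sub_self]
    exact zero_mem I

variable (I) in
/-- For the trivial group, the largest Tambara ideal whose value at the point is contained
in `I`. -/
def ofPoint : TambaraIdeal R where
  carrier := pointwiseIdeal I
  res_mem := res_mem_pointwiseIdeal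
  tr_mem := tr_mem_of_orbits res_mem_pointwiseIdeal fun f =>
    tr_mem_pointwiseIdeal (injective_of_isPretransitive f)
  nm_mem := nm_sub_nm_zero_mem_of_orbits res_mem_pointwiseIdeal fun f =>
    nm_sub_nm_zero_mem_pointwiseIdeal (injective_of_isPretransitive f)

theorem le_ofPoint_iff {J : TambaraIdeal R} : J ≤ ofPoint I ↔ J.carrier (point G) ≤ I := by
  refine ⟨fun h a ha => ?_, fun h X a ha => mem_pointwiseIdeal.2 fun x => h (J.res_mem x ha)⟩
  rw [← R.res_id a]
  exact mem_pointwiseIdeal.1 (h _ ha) _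

theorem isPrime_ofPoint (hI : I.IsPrime) : (ofPoint I).IsPrime := by
  refine ⟨fun h => hI.ne_top (top_le_iff.1 (le_ofPoint_iff.1 h.ge)), fun J K hJK => ?_⟩
  have h_point : J.carrier (point G) * K.carrier (point G) ≤ I :=
    Ideal.mul_le.2 fun a ha b hb => le_ofPoint_iff.1 hJK (mul_mem_mul ha hb)
  exact (hI.mul_le.1 h_point).imp le_ofPoint_iff.2 le_ofPoint_iff.2

end OfPoint

section Contraction

variable {G : Type u} [Group G] [Finite G] {R : TambaraFunctor.{u, v} G} {H : Subgroup G}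

/-- The restriction `Res_H^G I` of a Tambara ideal of `R` to a subgroup. -/
def restrict (I : TambaraIdeal R) (H : Subgroup G) : TambaraIdeal (R.resFunctor H) where
  carrier X := I.carrier (induce H X)
  res_mem f _ := I.res_mem (induceMap H f)
  tr_mem f _ := I.tr_mem (induceMap H f)
  nm_mem f _ := I.nm_mem (induceMap H f)

/-- The contraction of `CoInd_H^G Q` along the unit `R → CoInd_H^G Res_H^G R`. -/
def contraction (Q : TambaraIdeal (R.resFunctor H)) : TambaraIdeal R :=
  Q.coind.comap (R.coindUnit H)

theorem le_contraction_iff {I : TambaraIdeal R} {Q : TambaraIdeal (R.resFunctor H)} :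
    I ≤ Q.contraction ↔ I.restrict H ≤ Q := by
  refine ⟨fun h Y (a : R.obj (induce H Y)) ha => ?_, fun h X a ha =>
    h _ (I.res_mem (actMap H X) ha)⟩
  have h_retract : R.res (induceMap H (indUnit Y)) (R.res (actMap H (induce H Y)) a) = a := by
    rw [← R.res_comp, actMap_comp_induceMap_indUnit, R.res_id]
  rw [← h_retract]
  exact Q.res_mem (indUnit Y) (h _ ha)

theorem restrict_mul_le (I J : TambaraIdeal R) :
    I.restrict H * J.restrict H ≤ (I * J).restrict H :=
  mul_le.2 fun _ _ ha _ hb => mul_mem_mul (I := I) (J := J) ha hb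

theorem IsPrime.contraction {Q : TambaraIdeal (R.resFunctor H)} (hQ : Q.IsPrime) :
    Q.contraction.IsPrime := by
  refine ⟨fun h => hQ.1 (top_le_iff.1 (le_contraction_iff.1 h.ge)), fun I J hIJ => ?_⟩
  have h_restrict : I.restrict H * J.restrict H ≤ Q :=
    (restrict_mul_le I J).trans (le_contraction_iff.1 hIJ)
  exact (hQ.2 _ _ h_restrict).imp le_contraction_iff.2 le_contraction_iff.2

theorem res_actMap_mem_contraction_iff {Q : TambaraIdeal (R.resFunctor H)} {X : FinGSet G}
    {a : R.obj X} :
    R.res (actMap H X) a ∈ Q.contraction.carrier (induce H (FinGSet.restrict H X)) ↔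
      a ∈ Q.contraction.carrier X :=
  ⟨fun ha => le_contraction_iff.1 le_rfl _ ha, fun ha => Q.contraction.res_mem _ ha⟩

end Contraction

end TambaraIdeal

section Spectrum

variable {G : Type u} [Group G] {R : TambaraFunctor.{u, v} G}

theorem specializes_of_le {P Q : R.Spec} (h : P.1 ≤ Q.1) : P ⤳ Q := by
  rw [Specializes, TopologicalSpace.nhds_generateFrom, TopologicalSpace.nhds_generateFrom]
  refine biInf_mono ?_
  rintro _ ⟨hQ, I, rfl⟩
  exact ⟨fun hP => hQ (le_trans hP h), I, rfl⟩

theorem IsDomainLike.nontrivial_obj_point (hR : R.IsDomainLike) :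
    Nontrivial (R.obj (point G)) := by
  by_contra h
  have := not_nontrivial_iff_subsingleton.1 h
  have (X : FinGSet G) := R.subsingleton_of_subsingleton_obj (X := point G) X
  exact hR.1 (TambaraIdeal.ext (funext fun X => Subsingleton.elim _ _))

theorem nonempty_spec_of_subsingleton [Subsingleton G] [Nontrivial (R.obj (point G))] :
    Nonempty R.Spec := by
  obtain ⟨I, hI⟩ := Ideal.exists_maximal (R.obj (point G))
  exact ⟨⟨_, TambaraIdeal.isPrime_ofPoint hI.isPrime⟩⟩

variable [Finite G] (R) (H : Subgroup G)

/-- The map `Spec (Res_H^G R) → Spec R` whose image is the `H`-th stratum. -/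
def stratumMap (Q : (R.resFunctor H).Spec) : R.Spec := ⟨Q.1.contraction, Q.2.contraction⟩

theorem stratum_eq_range : R.stratum H = Set.range (R.stratumMap H) :=
  Set.ext fun P => exists_congr fun Q =>
    ⟨fun h => Subtype.ext h.symm, fun h : R.stratumMap H Q = P => h ▸ rfl⟩

theorem nonempty_spec [Nontrivial (R.obj (point G))] : Nonempty R.Spec :=
  (nonempty_spec_of_subsingleton (R := R.resFunctor ⊥)).map (R.stratumMap ⊥)

theorem stratum_nonempty [Nontrivial (R.obj (point G))] : (R.stratum H).Nonempty := by
  have := (R.resFunctor H).nonempty_spec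
  rw [stratum_eq_range]
  exact Set.range_nonempty _

variable {R H}

theorem res_actMap_mem_iff_of_mem_stratum {P : R.Spec} (hP : P ∈ R.stratum H) {X : FinGSet G}
    {a : R.obj X} :
    R.res (actMap H X) a ∈ P.1.carrier (induce H (restrict H X)) ↔ a ∈ P.1.carrier X := by
  obtain ⟨Q, hQ⟩ := hP
  rw [hQ]
  exact TambaraIdeal.res_actMap_mem_contraction_iff

end Spectrum

end TambaraFunctor

theorem mainTheorem10 {G : Type u} [Group G] [Finite G] (R : TambaraFunctor.{u, v} G)
    (hR : R.IsDomainLike) (H : Subgroup G)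
    (hH : ¬ Function.Injective (R.res (FinGSet.orbitMap (le_top : H ≤ (⊤ : Subgroup G))))) :
    ¬ IsOpen (R.stratum H) := by
  intro h_open
  have := hR.nontrivial_obj_point
  obtain ⟨P, hP⟩ := R.stratum_nonempty H
  have h_bot : (⟨⊥, hR⟩ : R.Spec) ∈ R.stratum H :=
    (TambaraFunctor.specializes_of_le (bot_le (a := P.1))).mem_open h_open hP
  refine hH ((injective_iff_map_eq_zero _).2 fun a ha => ?_)
  have h_act : R.res (FinGSet.actMap H (FinGSet.orbit ⊤)) a = 0 := by
    rw [FinGSet.actMap_orbit_top, R.res_comp, ha, map_zero]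
  exact (TambaraFunctor.res_actMap_mem_iff_of_mem_stratum h_bot).1 h_act
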